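/- Let $\mathbf{x}=\{x_i : i\in\mathbb{Z}\}$ be commuting variables. For $b\in\mathbb{Z}$ let $\mathrm{QSym}(\mathbf{x}_{\le b})$ be the $\mathbb{Q}$-algebra of quasisymmetric functions in the ordered alphabet $\mathbf{x}_{\le b}=\{x_i : i\le b\}$, i.e. of the bounded-degree formal power series $f\in\mathbb{Q}[\![\mathbf{x}]\!]$ that involve only variables $x_i$ with $i\le b$ and in which, for all positive integers $a_1,\dots,a_k$ and all $i_1<\cdots<i_k\le b$ and $j_1<\cdots<j_k\le b$, the coefficients of $x_{i_1}^{a_1}\cdots x_{i_k}^{a_k}$ and $x_{j_1}^{a_1}\cdots x_{j_k}^{a_k}$ are equal; write $\mathbf{x}_-=\mathbf{x}_{\le 0}$. Let $R\subseteq\mathbb{Q}[\![\mathbf{x}]\!]$ be the set of bounded-degree formal power series $f$ for which there is an $N\in\mathbb{Z}$ such that no $x_i$ with $i>N$ appears in $f$. A series $f\in R$ is called back quasisymmetric if there is a $b\in\mathbb{Z}$ such that, for all positive integers $a_1,\dots,a_k$, every monomial $\mathsf{m}$ in the variables $x_i$, $i>b$, and all $i_1<\cdots<i_k\le b$ and $j_1<\cdots<j_k\le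 b$, the coefficients of $x_{i_1}^{a_1}\cdots x_{i_k}^{a_k}\mathsf{m}$ and $x_{j_1}^{a_1}\cdots x_{j_k}^{a_k}\mathsf{m}$ in $f$ are equal. Let $\overleftarrow{QR}$ be the space of back quasisymmetric functions. Then $$\overleftarrow{QR}=\mathrm{QSym}(\mathbf{x}_-)\otimes_{\mathbb{Q}}\mathbb{Q}[\mathbf{x}],$$ that is, the natural map $\mathrm{QSym}(\mathbf{x}_-)\otimes_{\mathbb{Q}}\mathbb{Q}[\mathbf{x}]\to\mathbb{Q}[\![\mathbf{x}]\!]$, $f\otimes p\mapsto fp$, is injective and its image is exactly $\overleftarrow{QR}$. -/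

import Mathlib

open scoped TensorProduct

namespace BackQuasi

/-- Formal power series over `ℚ` in the variables `x_i`, `i ∈ ℤ`. -/
abbrev Series : Type := MvPowerSeries ℤ ℚ

/-- The exponent vector of the monomial `x_{i_1}^{a_1} ⋯ x_{i_k}^{a_k}`. -/
noncomputable def expo {k : ℕ} (i : Fin k → ℤ) (a : Fin k → ℕ) : ℤ →₀ ℕ :=
  ∑ r, Finsupp.single (i r) (a r)

/-- The degrees of the monomials that occur in `f` are bounded. -/
def BoundedDegree (f : Series) : Prop :=
  ∃ n : ℕ, ∀ d : ℤ →₀ ℕ, MvPowerSeries.coeff d f ≠ 0 → d.degree ≤ n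

/-- No variable `x_i` with `i > N` appears in `f`. -/
def VarsLE (N : ℤ) (f : Series) : Prop :=
  ∀ d : ℤ →₀ ℕ, MvPowerSeries.coeff d f ≠ 0 → ∀ i ∈ d.support, i ≤ N

/-- Quasisymmetry in the ordered alphabet `x_i`, `i ≤ b`. -/
def IsQuasisymmetric (b : ℤ) (f : Series) : Prop :=
  ∀ (k : ℕ) (a : Fin k → ℕ), (∀ r, 0 < a r) →
    ∀ i j : Fin k → ℤ, StrictMono i → StrictMono j → (∀ r, i r ≤ b) → (∀ r, j r ≤ b) →
      MvPowerSeries.coeff (expo i a) f = MvPowerSeries.coeff (expo j a) f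

/-- Quasisymmetry in the variables `x_i`, `i ≤ b`, of the coefficient of every monomial `m` in
the variables `x_i`, `i > b`. -/
def IsBackQuasisymmetricAt (b : ℤ) (f : Series) : Prop :=
  ∀ (k : ℕ) (a : Fin k → ℕ), (∀ r, 0 < a r) →
    ∀ m : ℤ →₀ ℕ, (∀ t ∈ m.support, b < t) →
    ∀ i j : Fin k → ℤ, StrictMono i → StrictMono j → (∀ r, i r ≤ b) → (∀ r, j r ≤ b) →
      MvPowerSeries.coeff (expo i a + m) f = MvPowerSeries.coeff (expo j a + m) f

/-! ### Helper facts: closure under the algebra operations -/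

/-- Invariance under relabellings of the variables; used only to prove closure properties. -/
def RelabelInvariant (b : ℤ) (f : Series) : Prop :=
  ∀ (d : ℤ →₀ ℕ) (g : ℤ → ℤ), StrictMonoOn g d.support →
    (∀ t ∈ d.support, t ≤ b → g t ≤ b) → (∀ t ∈ d.support, b < t → g t = t) →
      MvPowerSeries.coeff (d.mapDomain g) f = MvPowerSeries.coeff d f

theorem mem_support_expo {k : ℕ} {i : Fin k → ℤ} {a : Fin k → ℕ} {t : ℤ}
    (h : t ∈ (expo i a).support) : ∃ r, i r = t := by
  classical
  have := Finsupp.support_finsetSum h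
  simp only [Finset.mem_biUnion, Finset.mem_univ, true_and] at this
  obtain ⟨r, hr⟩ := this
  exact ⟨r, (Finset.mem_singleton.1 (Finsupp.support_single_subset hr)).symm⟩

theorem mapDomain_expo {k : ℕ} (i : Fin k → ℤ) (a : Fin k → ℕ) (g : ℤ → ℤ) :
    (expo i a).mapDomain g = expo (fun r => g (i r)) a := by
  simp [expo, Finsupp.mapDomain_finsetSum, Finsupp.mapDomain_single]

theorem exists_expo (e : ℤ →₀ ℕ) : ∃ (k : ℕ) (i : Fin k → ℤ) (a : Fin k → ℕ),
    StrictMono i ∧ (∀ r, i r ∈ e.support) ∧ (∀ r, 0 < a r) ∧ expo i a = e := by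
  refine ⟨e.support.card, e.support.orderEmbOfFin rfl,
    fun r => e (e.support.orderEmbOfFin rfl r), (e.support.orderEmbOfFin rfl).strictMono,
    fun r => e.support.orderEmbOfFin_mem rfl r, fun r => ?_, ?_⟩
  · exact Nat.pos_of_ne_zero (Finsupp.mem_support_iff.1 (e.support.orderEmbOfFin_mem rfl r))
  · conv_rhs => rw [← Finsupp.sum_single e, Finsupp.sum]
    have h := Finset.sum_map (Finset.univ : Finset (Fin e.support.card))
      (e.support.orderEmbOfFin rfl).toEmbedding (fun t => Finsupp.single t (e t))
    rw [Finset.map_orderEmbOfFin_univ] at h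
    exact h.symm

theorem mapDomain_eq_self {e : ℤ →₀ ℕ} {g : ℤ → ℤ} (h : ∀ t ∈ e.support, g t = t) :
    e.mapDomain g = e := by
  conv_rhs => rw [← Finsupp.mapDomain_id (v := e)]
  exact Finsupp.mapDomain_congr h

theorem relabelInvariant_iff {b : ℤ} {f : Series} :
    RelabelInvariant b f ↔ IsBackQuasisymmetricAt b f := by
  classical
  constructor
  · intro h k a _ m hm i j hi hj hib hjb
    have hg : ∀ r, Function.extend i j id (i r) = j r := fun r => hi.injective.extend_apply j id r
    have hg' : ∀ t, b < t → Function.extend i j id t = t := by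
      intro t ht
      rw [Function.extend_apply']
      · rfl
      · rintro ⟨r, rfl⟩
        exact absurd (hib r) (not_le.2 ht)
    have hs : ∀ t ∈ (expo i a + m).support, (∃ r, i r = t) ∨ b < t := by
      intro t ht
      rcases Finset.mem_union.1 (Finsupp.support_add ht) with h1 | h1
      · exact Or.inl (mem_support_expo h1)
      · exact Or.inr (hm t h1)
    have key := h (expo i a + m) (Function.extend i j id) ?_ ?_ ?_
    · rw [← key, Finsupp.mapDomain_add, mapDomain_expo, mapDomain_eq_self fun t ht => hg' t (hm t ht)]
      simp only [hg]
    · intro s hs1 t ht1 hst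
      rcases hs s hs1 with ⟨r, rfl⟩ | h1 <;> rcases hs t ht1 with ⟨u, rfl⟩ | h2
      · rw [hg, hg]
        exact hj (hi.lt_iff_lt.1 hst)
      · rw [hg, hg' t h2]
        exact (hjb r).trans_lt h2
      · exact absurd ((h1.trans hst).trans_le (hib u)) (lt_irrefl _)
      · rwa [hg' s h1, hg' t h2]
    · intro t ht htb
      rcases hs t ht with ⟨r, rfl⟩ | h1
      · rw [hg]
        exact hjb r
      · exact absurd htb (not_le.2 h1)
    · intro t _ htb
      exact hg' t htb
  · intro h d g hg h1 h2
    obtain ⟨k, i, a, hi, hie, ha, he⟩ := exists_expo (d.filter (· ≤ b))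
    have hmem : ∀ r, i r ∈ d.support ∧ i r ≤ b := by
      intro r
      have := hie r
      rw [Finsupp.support_filter, Finset.mem_filter] at this
      exact this
    have hmm : ∀ t ∈ (d.filter (fun t => ¬ t ≤ b)).support, t ∈ d.support ∧ b < t := by
      intro t ht
      rw [Finsupp.support_filter, Finset.mem_filter, not_le] at ht
      exact ht
    have hd : expo i a + d.filter (fun t => ¬ t ≤ b) = d := by
      rw [he]
      exact Finsupp.filter_add_filter_not d (· ≤ b)
    have hgd : d.mapDomain g = expo (fun r => g (i r)) a + d.filter (fun t => ¬ t ≤ b) := by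
      conv_lhs => rw [← hd]
      rw [Finsupp.mapDomain_add, mapDomain_expo,
        mapDomain_eq_self fun t ht => h2 t (hmm t ht).1 (hmm t ht).2]
    rw [hgd]
    conv_rhs => rw [← hd]
    refine h k a ha _ (fun t ht => (hmm t ht).2) _ _ ?_ hi ?_ (fun r => (hmem r).2)
    · intro r u hru
      exact hg (hmem r).1 (hmem u).1 (hi hru)
    · intro r
      exact h1 _ (hmem r).1 (hmem r).2

theorem IsBackQuasisymmetricAt.mono {b c : ℤ} {f : Series} (hcb : c ≤ b)
    (h : IsBackQuasisymmetricAt b f) : IsBackQuasisymmetricAt c f := by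
  rw [← relabelInvariant_iff] at h ⊢
  intro d g hg h1 h2
  refine h d g hg (fun t ht htb => ?_) fun t ht htb => h2 t ht (hcb.trans_lt htb)
  rcases le_or_gt t c with h3 | h3
  · exact (h1 t ht h3).trans hcb
  · rwa [h2 t ht h3]

theorem IsBackQuasisymmetricAt.add {b : ℤ} {f h : Series}
    (hf : IsBackQuasisymmetricAt b f) (hh : IsBackQuasisymmetricAt b h) :
    IsBackQuasisymmetricAt b (f + h) := by
  intro k a ha m hm i j hi hj hib hjb
  rw [map_add, map_add, hf k a ha m hm i j hi hj hib hjb, hh k a ha m hm i j hi hj hib hjb]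

theorem IsBackQuasisymmetricAt.mul {b : ℤ} {f h : Series}
    (hf : IsBackQuasisymmetricAt b f) (hh : IsBackQuasisymmetricAt b h) :
    IsBackQuasisymmetricAt b (f * h) := by
  classical
  rw [← relabelInvariant_iff] at hf hh ⊢
  intro d g hg h1 h2
  have hinv : ∀ t ∈ d.support, Function.invFunOn g d.support (g t) = t := fun t ht =>
    hg.injOn.leftInvOn_invFunOn ht
  have hsub : ∀ p q : ℤ →₀ ℕ, p.support ⊆ (p + q).support := by
    intro p q t ht
    rw [Finsupp.mem_support_iff] at ht ⊢
    rw [Finsupp.add_apply]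
    omega
  have hleft : ∀ p : ℤ →₀ ℕ, p.support ⊆ d.support →
      (p.mapDomain g).mapDomain (Function.invFunOn g d.support) = p := by
    intro p hp
    rw [← Finsupp.mapDomain_comp]
    exact mapDomain_eq_self fun t ht => hinv t (hp ht)
  have hright : ∀ p : ℤ →₀ ℕ, p.support ⊆ (d.mapDomain g).support →
      (p.mapDomain (Function.invFunOn g d.support)).mapDomain g = p := by
    intro p hp
    rw [← Finsupp.mapDomain_comp]
    refine mapDomain_eq_self fun t ht => ?_
    obtain ⟨s, hs, rfl⟩ := Finset.mem_image.1 (Finsupp.mapDomain_support (hp ht))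
    rw [Function.comp_apply, hinv s hs]
  rw [MvPowerSeries.coeff_mul, MvPowerSeries.coeff_mul]
  symm
  refine Finset.sum_bij' (fun p _ => (p.1.mapDomain g, p.2.mapDomain g))
    (fun p _ => (p.1.mapDomain (Function.invFunOn g d.support),
      p.2.mapDomain (Function.invFunOn g d.support))) ?_ ?_ ?_ ?_ ?_
  · rintro ⟨p, q⟩ hpq
    rw [Finset.HasAntidiagonal.mem_antidiagonal] at hpq ⊢
    simp only at hpq ⊢
    rw [← Finsupp.mapDomain_add, hpq]
  · rintro ⟨p, q⟩ hpq
    rw [Finset.HasAntidiagonal.mem_antidiagonal] at hpq ⊢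
    simp only at hpq ⊢
    rw [← Finsupp.mapDomain_add, hpq, hleft d subset_rfl]
  · rintro ⟨p, q⟩ hpq
    rw [Finset.HasAntidiagonal.mem_antidiagonal] at hpq
    simp only at hpq
    exact Prod.ext (hleft p (hpq ▸ hsub p q)) (hleft q (hpq ▸ add_comm q p ▸ hsub q p))
  · rintro ⟨p, q⟩ hpq
    rw [Finset.HasAntidiagonal.mem_antidiagonal] at hpq
    simp only at hpq
    exact Prod.ext (hright p (hpq ▸ hsub p q)) (hright q (hpq ▸ add_comm q p ▸ hsub q p))
  · rintro ⟨p, q⟩ hpq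
    rw [Finset.HasAntidiagonal.mem_antidiagonal] at hpq
    simp only at hpq
    have hp : p.support ⊆ d.support := hpq ▸ hsub p q
    have hq : q.support ⊆ d.support := hpq ▸ add_comm q p ▸ hsub q p
    simp only
    rw [hf p g (hg.mono hp) (fun t ht => h1 t (hp ht)) (fun t ht => h2 t (hp ht)),
      hh q g (hg.mono hq) (fun t ht => h1 t (hq ht)) (fun t ht => h2 t (hq ht))]

theorem isBackQuasisymmetricAt_algebraMap (b : ℤ) (c : ℚ) :
    IsBackQuasisymmetricAt b (algebraMap ℚ Series c) := by
  classical
  intro k a ha m _ i j _ _ _ _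
  have h0 : ∀ i : Fin k → ℤ, expo i a + m = 0 ↔ k = 0 ∧ m = 0 := by
    intro i
    constructor
    · intro h
      have hm : m = 0 := (add_eq_zero.1 h).2
      have he : expo i a = 0 := (add_eq_zero.1 h).1
      refine ⟨?_, hm⟩
      by_contra hk
      have := Finset.sum_eq_zero_iff.1 he ⟨0, Nat.pos_of_ne_zero hk⟩ (Finset.mem_univ _)
      exact (ha ⟨0, Nat.pos_of_ne_zero hk⟩).ne' (Finsupp.single_eq_zero.1 this)
    · rintro ⟨rfl, rfl⟩
      simp [expo]
  rw [MvPowerSeries.algebraMap_apply, MvPowerSeries.coeff_C, MvPowerSeries.coeff_C]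
  simp only [h0]

theorem isBackQuasisymmetricAt_iff {b : ℤ} {f : Series} (hv : VarsLE b f) :
    IsBackQuasisymmetricAt b f ↔ IsQuasisymmetric b f := by
  constructor
  · intro h k a ha i j hi hj hib hjb
    simpa using h k a ha 0 (by simp) i j hi hj hib hjb
  · intro h k a ha m hm i j hi hj hib hjb
    by_cases h0 : m = 0
    · subst h0
      simpa using h k a ha i j hi hj hib hjb
    · obtain ⟨t, ht⟩ := Finsupp.support_nonempty_iff.2 h0
      have hz : ∀ e : ℤ →₀ ℕ, MvPowerSeries.coeff (e + m) f = 0 := by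
        intro e
        by_contra hne
        refine absurd (hv _ hne t ?_) (not_le.2 (hm t ht))
        rw [Finsupp.mem_support_iff] at ht ⊢
        rw [Finsupp.add_apply]
        omega
      rw [hz, hz]

theorem exists_of_coeff_add_ne_zero {f h : Series} {d : ℤ →₀ ℕ}
    (hd : MvPowerSeries.coeff d (f + h) ≠ 0) :
    MvPowerSeries.coeff d f ≠ 0 ∨ MvPowerSeries.coeff d h ≠ 0 := by
  by_contra! hc
  exact hd (by rw [map_add, hc.1, hc.2, add_zero])

theorem exists_of_coeff_mul_ne_zero {f h : Series} {d : ℤ →₀ ℕ}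
    (hd : MvPowerSeries.coeff d (f * h) ≠ 0) :
    ∃ p q, p + q = d ∧ MvPowerSeries.coeff p f ≠ 0 ∧ MvPowerSeries.coeff q h ≠ 0 := by
  classical
  rw [MvPowerSeries.coeff_mul] at hd
  obtain ⟨⟨p, q⟩, hpq, hne⟩ := Finset.exists_ne_zero_of_sum_ne_zero hd
  exact ⟨p, q, Finset.HasAntidiagonal.mem_antidiagonal.1 hpq, left_ne_zero_of_mul hne, right_ne_zero_of_mul hne⟩

theorem eq_zero_of_coeff_algebraMap_ne_zero {c : ℚ} {d : ℤ →₀ ℕ}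
    (hd : MvPowerSeries.coeff d (algebraMap ℚ Series c) ≠ 0) : d = 0 := by
  classical
  rw [MvPowerSeries.algebraMap_apply, MvPowerSeries.coeff_C] at hd
  by_contra h
  exact hd (if_neg h)

theorem BoundedDegree.add {f h : Series} (hf : BoundedDegree f) (hh : BoundedDegree h) :
    BoundedDegree (f + h) := by
  obtain ⟨n, hn⟩ := hf
  obtain ⟨m, hm⟩ := hh
  refine ⟨max n m, fun d hd => ?_⟩
  rcases exists_of_coeff_add_ne_zero hd with h1 | h1
  · exact (hn d h1).trans (le_max_left _ _)
  · exact (hm d h1).trans (le_max_right _ _)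

theorem BoundedDegree.mul {f h : Series} (hf : BoundedDegree f) (hh : BoundedDegree h) :
    BoundedDegree (f * h) := by
  obtain ⟨n, hn⟩ := hf
  obtain ⟨m, hm⟩ := hh
  refine ⟨n + m, fun d hd => ?_⟩
  obtain ⟨p, q, rfl, hp, hq⟩ := exists_of_coeff_mul_ne_zero hd
  rw [map_add]
  exact add_le_add (hn p hp) (hm q hq)

theorem boundedDegree_algebraMap (c : ℚ) : BoundedDegree (algebraMap ℚ Series c) :=
  ⟨0, fun d hd => by simp [eq_zero_of_coeff_algebraMap_ne_zero hd]⟩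

theorem VarsLE.mono {M N : ℤ} {f : Series} (hMN : M ≤ N) (hf : VarsLE M f) : VarsLE N f :=
  fun d hd i hi => (hf d hd i hi).trans hMN

theorem VarsLE.add {N : ℤ} {f h : Series} (hf : VarsLE N f) (hh : VarsLE N h) :
    VarsLE N (f + h) := by
  intro d hd i hi
  rcases exists_of_coeff_add_ne_zero hd with h1 | h1
  · exact hf d h1 i hi
  · exact hh d h1 i hi

theorem VarsLE.mul {N : ℤ} {f h : Series} (hf : VarsLE N f) (hh : VarsLE N h) :
    VarsLE N (f * h) := by
  classical
  intro d hd i hi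
  obtain ⟨p, q, rfl, hp, hq⟩ := exists_of_coeff_mul_ne_zero hd
  rcases Finset.mem_union.1 (Finsupp.support_add hi) with h1 | h1
  · exact hf p hp i h1
  · exact hh q hq i h1

theorem varsLE_algebraMap (N : ℤ) (c : ℚ) : VarsLE N (algebraMap ℚ Series c) := by
  intro d hd i hi
  simp [eq_zero_of_coeff_algebraMap_ne_zero hd] at hi

/-! ### The algebras -/

/-- The algebra `R` of series of bounded degree in which, for some `N`, no `x_i` with `i > N`
appears. -/
noncomputable def R : Subalgebra ℚ Series where
  carrier := {f | BoundedDegree f ∧ ∃ N : ℤ, VarsLE N f}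
  add_mem' := by
    rintro f h ⟨hf, M, hM⟩ ⟨hh, N, hN⟩
    exact ⟨hf.add hh, max M N, (hM.mono (le_max_left _ _)).add (hN.mono (le_max_right _ _))⟩
  mul_mem' := by
    rintro f h ⟨hf, M, hM⟩ ⟨hh, N, hN⟩
    exact ⟨hf.mul hh, max M N, (hM.mono (le_max_left _ _)).mul (hN.mono (le_max_right _ _))⟩
  algebraMap_mem' := fun c => ⟨boundedDegree_algebraMap c, 0, varsLE_algebraMap 0 c⟩

/-- `QSym(x_{≤ b})`: the algebra of quasisymmetric functions (of bounded degree) in the ordered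
alphabet `x_i`, `i ≤ b`. -/
noncomputable def QSym (b : ℤ) : Subalgebra ℚ Series where
  carrier := {f | BoundedDegree f ∧ VarsLE b f ∧ IsQuasisymmetric b f}
  add_mem' := by
    rintro f h ⟨hf, hfv, hfq⟩ ⟨hh, hhv, hhq⟩
    rw [← isBackQuasisymmetricAt_iff hfv] at hfq
    rw [← isBackQuasisymmetricAt_iff hhv] at hhq
    exact ⟨hf.add hh, hfv.add hhv, (isBackQuasisymmetricAt_iff (hfv.add hhv)).1 (hfq.add hhq)⟩
  mul_mem' := by
    rintro f h ⟨hf, hfv, hfq⟩ ⟨hh, hhv, hhq⟩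
    rw [← isBackQuasisymmetricAt_iff hfv] at hfq
    rw [← isBackQuasisymmetricAt_iff hhv] at hhq
    exact ⟨hf.mul hh, hfv.mul hhv, (isBackQuasisymmetricAt_iff (hfv.mul hhv)).1 (hfq.mul hhq)⟩
  algebraMap_mem' := fun c => ⟨boundedDegree_algebraMap c, varsLE_algebraMap b c,
    (isBackQuasisymmetricAt_iff (varsLE_algebraMap b c)).1 (isBackQuasisymmetricAt_algebraMap b c)⟩

/-- The algebra of back quasisymmetric functions. -/
noncomputable def BackQSym : Subalgebra ℚ Series where
  carrier := {f | f ∈ R ∧ ∃ b : ℤ, IsBackQuasisymmetricAt b f}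
  add_mem' := by
    rintro f h ⟨hf, b, hb⟩ ⟨hh, c, hc⟩
    exact ⟨R.add_mem hf hh, min b c,
      (hb.mono (min_le_left _ _)).add (hc.mono (min_le_right _ _))⟩
  mul_mem' := by
    rintro f h ⟨hf, b, hb⟩ ⟨hh, c, hc⟩
    exact ⟨R.mul_mem hf hh, min b c,
      (hb.mono (min_le_left _ _)).mul (hc.mono (min_le_right _ _))⟩
  algebraMap_mem' := fun c => ⟨R.algebraMap_mem c, 0, isBackQuasisymmetricAt_algebraMap 0 c⟩

/-- The natural map `QSym(x_{≤ 0}) ⊗ ℚ[x] → ℚ⟦x⟧`, `f ⊗ p ↦ f * p`. -/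
noncomputable def naturalMap : QSym 0 ⊗[ℚ] MvPolynomial ℤ ℚ →ₐ[ℚ] Series :=
  Algebra.TensorProduct.productMap (QSym 0).val (MvPolynomial.coeToMvPowerSeries.algHom ℚ)

end BackQuasi

namespace BackQuasi

open MvPowerSeries

/-! ### The image consists of back quasisymmetric functions -/

/-! The image lies in `BackQSym` because that algebra contains `QSym 0` and every variable.

Surjectivity is an induction on a degree bound. Let `f` be back quasisymmetric at `b ≤ 0`. Its part
in the variables up to `b` is quasisymmetric there, and shifting indices by `-b` extends it to some
`G` in `QSym 0` with the same coefficients on monomials in those variables. So every monomial of `f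
- G` contains a variable beyond `b`. Sorting by last variable gives a finite sum of terms `x_t *
g_t` with `b < t ≤ N`; each `g_t` is back quasisymmetric at the same `b` and has a smaller degree
bound (`mem_range_of_degree_lt`).

For injectivity, write a kernel element as a finite sum of `c m ⊗ m` over monomials `m`. Take a
monomial `d` of maximal degree among all those in the `c m`, and shift it to the left of every
variable in the `m`; quasisymmetry preserves its coefficient. By maximality the product of the
shifted `d` with its `m` arises in only one way, so that coefficient must vanish, a contradiction
(`coeff_sum_mul_monomial_of_maximal`). -/

theorem relabelInvariant_of_mem_QSym {b : ℤ} {f : Series} (hf : f ∈ QSym b) :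
    RelabelInvariant b f :=
  relabelInvariant_iff.2 ((isBackQuasisymmetricAt_iff hf.2.1).2 hf.2.2)

theorem QSym_le_BackQSym (b : ℤ) : QSym b ≤ BackQSym := fun _ hf =>
  ⟨⟨hf.1, b, hf.2.1⟩, b, (isBackQuasisymmetricAt_iff hf.2.1).2 hf.2.2⟩

theorem isBackQuasisymmetricAt_X {b t : ℤ} (hbt : b < t) :
    IsBackQuasisymmetricAt b (X t : Series) := by
  classical
  intro k a ha m _ i j _ _ hib hjb
  rcases k with _ | k
  · rw [Subsingleton.elim i j]
  · have hz : ∀ i : Fin (k + 1) → ℤ, (∀ r, i r ≤ b) →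
        MvPowerSeries.coeff (expo i a + m) (X t : Series) = 0 := by
      intro i hib
      rw [coeff_X, if_neg]
      intro h
      have h1 := DFunLike.congr_fun h (i 0)
      rw [Finsupp.single_eq_of_ne (by have := hib 0; omega), Finsupp.add_apply, expo,
        Finsupp.finsetSum_apply] at h1
      have h2 := Finset.single_le_sum (f := fun r => Finsupp.single (i r) (a r) (i 0))
        (fun _ _ => Nat.zero_le _) (Finset.mem_univ 0)
      simp only [Finsupp.single_eq_same] at h2
      have := ha 0
      omega
    -- For `k > 0` both monomials contain a variable of index at most `b < t`, so neither is `x_t`.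
    rw [hz i hib, hz j hjb]

theorem X_mem_BackQSym (t : ℤ) : (X t : Series) ∈ BackQSym := by
  classical
  have hd : ∀ d : ℤ →₀ ℕ, MvPowerSeries.coeff d (X t : Series) ≠ 0 → d = Finsupp.single t 1 := by
    intro d hd
    rw [coeff_X] at hd
    by_contra h
    exact hd (if_neg h)
  refine ⟨⟨⟨1, fun d h => ?_⟩, t, fun d h i hi => ?_⟩, t - 1, isBackQuasisymmetricAt_X (by omega)⟩
  · rw [hd d h, Finsupp.degree_single]
  · rw [hd d h] at hi
    exact (Finset.mem_singleton.1 (Finsupp.support_single_subset hi)).le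

theorem naturalMap_tmul (f : QSym 0) (p : MvPolynomial ℤ ℚ) :
    naturalMap (f ⊗ₜ p) = (f : Series) * (p : Series) := by
  simp [naturalMap, MvPolynomial.coeToMvPowerSeries.algHom_apply]

theorem coe_mem_BackQSym (p : MvPolynomial ℤ ℚ) : (p : Series) ∈ BackQSym := by
  induction p using MvPolynomial.induction_on with
  | C c =>
    rw [MvPolynomial.coe_C]
    exact BackQSym.algebraMap_mem c
  | add p q hp hq =>
    rw [MvPolynomial.coe_add]
    exact BackQSym.add_mem hp hq
  | mul_X p t hp =>
    rw [MvPolynomial.coe_mul, MvPolynomial.coe_X]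
    exact BackQSym.mul_mem hp (X_mem_BackQSym t)

theorem range_naturalMap_le : naturalMap.range ≤ BackQSym := by
  rintro _ ⟨z, rfl⟩
  change naturalMap z ∈ BackQSym
  induction z using TensorProduct.induction_on with
  | zero =>
    rw [map_zero]
    exact BackQSym.zero_mem
  | tmul f p =>
    rw [naturalMap_tmul]
    exact BackQSym.mul_mem (QSym_le_BackQSym 0 f.2) (coe_mem_BackQSym p)
  | add y z hy hz =>
    rw [map_add]
    exact BackQSym.add_mem hy hz

/-! ### Every back quasisymmetric function is in the image -/

theorem QSym_le_range : QSym 0 ≤ naturalMap.range := fun f hf =>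
  ⟨(⟨f, hf⟩ : QSym 0) ⊗ₜ 1, by
    change naturalMap _ = _
    rw [naturalMap_tmul, MvPolynomial.coe_one, mul_one]⟩

theorem X_mem_range (t : ℤ) : (X t : Series) ∈ naturalMap.range :=
  ⟨1 ⊗ₜ MvPolynomial.X t, by
    change naturalMap _ = _
    rw [naturalMap_tmul, MvPolynomial.coe_X, OneMemClass.coe_one, one_mul]⟩

theorem degree_mapDomain {σ τ : Type*} (g : σ → τ) (d : σ →₀ ℕ) :
    (d.mapDomain g).degree = d.degree := by
  classical
  induction d using Finsupp.induction_linear with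
  | zero => simp
  | add p q hp hq => rw [Finsupp.mapDomain_add, map_add, map_add, hp, hq]
  | single a n => simp

theorem mem_support_mapDomain_add {d : ℤ →₀ ℕ} {b t : ℤ}
    (ht : t ∈ (d.mapDomain (· + b)).support) : ∃ s ∈ d.support, s + b = t := by
  classical
  simpa using Finset.mem_image.1 (Finsupp.mapDomain_support ht)

/-- A leftward shift is an order-preserving relabelling that stays within the indices up to `b`.
This serves both surjectivity and injectivity. -/
theorem RelabelInvariant.coeff_mapDomain_add {b c : ℤ} {f : Series} (hf : RelabelInvariant b f)
    (hc : c ≤ 0) {d : ℤ →₀ ℕ} (hd : ∀ t ∈ d.support, t ≤ b) :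
    MvPowerSeries.coeff (d.mapDomain (· + c)) f = MvPowerSeries.coeff d f := by
  refine hf d _ (fun s _ t _ hst => by simpa using hst) (fun t _ htb => ?_) fun t ht htb => ?_
  · omega
  · exact absurd (hd t ht) (not_le.2 htb)

open Classical in
/-- The series in the variables `x_i`, `i ≤ 0`, obtained from the part of `f` in the variables
`x_i`, `i ≤ b`, by translating the indices by `-b`. -/
noncomputable def translate (b : ℤ) (f : Series) : Series := fun d =>
  if ∀ t ∈ d.support, t ≤ 0 then MvPowerSeries.coeff (d.mapDomain (· + b)) f else 0

open Classical in
theorem coeff_translate (b : ℤ) (f : Series) (d : ℤ →₀ ℕ) :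
    MvPowerSeries.coeff d (translate b f) =
      if ∀ t ∈ d.support, t ≤ 0 then MvPowerSeries.coeff (d.mapDomain (· + b)) f else 0 := rfl

theorem degree_lt_of_coeff_translate_ne_zero {b : ℤ} {f : Series} {n : ℕ}
    (hn : ∀ d, MvPowerSeries.coeff d f ≠ 0 → d.degree < n) {d : ℤ →₀ ℕ}
    (hd : MvPowerSeries.coeff d (translate b f) ≠ 0) : d.degree < n := by
  rw [coeff_translate] at hd
  rw [← degree_mapDomain (· + b) d]
  exact hn _ fun h => hd (by rw [h, ite_self])

theorem translate_mem_QSym {b : ℤ} {f : Series} {n : ℕ}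
    (hn : ∀ d, MvPowerSeries.coeff d f ≠ 0 → d.degree < n) (hf : IsBackQuasisymmetricAt b f) :
    translate b f ∈ QSym 0 := by
  refine ⟨⟨n, fun d hd => (degree_lt_of_coeff_translate_ne_zero hn hd).le⟩, fun d hd => ?_, ?_⟩
  · by_contra h
    exact hd (by rw [coeff_translate, if_neg h])
  · intro k a ha i j hi hj hib hjb
    have hsupp : ∀ i : Fin k → ℤ, (∀ r, i r ≤ 0) → ∀ t ∈ (expo i a).support, t ≤ 0 := by
      intro i hib t ht
      obtain ⟨r, rfl⟩ := mem_support_expo ht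
      exact hib r
    rw [coeff_translate, coeff_translate, if_pos (hsupp i hib), if_pos (hsupp j hjb),
      mapDomain_expo, mapDomain_expo]
    have := hf k a ha 0 (by simp) (fun r => i r + b) (fun r => j r + b)
      (fun r s h => by simpa using hi h) (fun r s h => by simpa using hj h)
      (fun r => by have := hib r; omega) (fun r => by have := hjb r; omega)
    simpa using this

open Classical in
/-- The sum of the terms of `f` in which `x_t` is the last variable, divided by `x_t`. -/
noncomputable def lastVarPart (t : ℤ) (f : Series) : Series := fun d =>
  if ∀ s ∈ d.support, s ≤ t then MvPowerSeries.coeff (d + Finsupp.single t 1) f else 0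

open Classical in
theorem coeff_lastVarPart (t : ℤ) (f : Series) (d : ℤ →₀ ℕ) :
    MvPowerSeries.coeff d (lastVarPart t f) =
      if ∀ s ∈ d.support, s ≤ t then MvPowerSeries.coeff (d + Finsupp.single t 1) f else 0 := rfl

theorem support_add_eq {σ : Type*} [DecidableEq σ] (p q : σ →₀ ℕ) :
    (p + q).support = p.support ∪ q.support := by
  ext t
  simp only [Finsupp.mem_support_iff, Finsupp.add_apply, Finset.mem_union]
  omega

/-- As `b < t`, the extra factor `x_t` is absorbed into `m`, and the cutoff at `t` constrains only
`m`. -/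
theorem isBackQuasisymmetricAt_lastVarPart {b t : ℤ} {f : Series} (hbt : b < t)
    (hf : IsBackQuasisymmetricAt b f) : IsBackQuasisymmetricAt b (lastVarPart t f) := by
  classical
  intro k a ha m hm i j hi hj hib hjb
  have hs : ∀ i : Fin k → ℤ, (∀ r, i r ≤ b) →
      ((∀ s ∈ (expo i a + m).support, s ≤ t) ↔ ∀ s ∈ m.support, s ≤ t) := by
    intro i hib
    simp only [support_add_eq, Finset.mem_union]
    refine ⟨fun h s hs => h s (Or.inr hs), fun h s hs => hs.elim (fun h1 => ?_) (h s)⟩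
    obtain ⟨r, rfl⟩ := mem_support_expo h1
    exact (hib r).trans hbt.le
  simp only [coeff_lastVarPart, hs i hib, hs j hjb, add_assoc]
  refine if_congr Iff.rfl (hf k a ha _ (fun s hs => ?_) i j hi hj hib hjb) rfl
  rcases Finset.mem_union.1 (Finsupp.support_add hs) with h1 | h1
  · exact hm s h1
  · rwa [Finset.mem_singleton.1 (Finsupp.support_single_subset h1)]

open Classical in
theorem coeff_X_mul_lastVarPart (t : ℤ) (f : Series) (d : ℤ →₀ ℕ) :
    MvPowerSeries.coeff d (X t * lastVarPart t f) =
      if t ∈ d.support ∧ ∀ s ∈ d.support, s ≤ t then MvPowerSeries.coeff d f else 0 := by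
  rw [X, coeff_monomial_mul, one_mul, coeff_lastVarPart]
  by_cases ht : t ∈ d.support
  · have hle : Finsupp.single t 1 ≤ d := by
      rw [Finsupp.single_le_iff]
      exact Nat.one_le_iff_ne_zero.2 (Finsupp.mem_support_iff.1 ht)
    have hs : (∀ s ∈ (d - Finsupp.single t 1).support, s ≤ t) ↔ ∀ s ∈ d.support, s ≤ t := by
      conv_rhs => rw [← tsub_add_cancel_of_le hle]
      simp only [support_add_eq, Finset.mem_union]
      refine ⟨fun h s hs => hs.elim (h s) fun h1 => ?_, fun h s hs => h s (Or.inl hs)⟩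
      exact (Finset.mem_singleton.1 (Finsupp.support_single_subset h1)).le
    simp only [if_pos hle, hs, ht, true_and, tsub_add_cancel_of_le hle]
  · rw [if_neg, if_neg fun h => ht h.1]
    rw [Finsupp.single_le_iff]
    rw [Finsupp.mem_support_iff] at ht
    omega

theorem eq_sum_X_mul_lastVarPart {b N : ℤ} {f : Series} (hN : VarsLE N f)
    (h0 : ∀ d : ℤ →₀ ℕ, (∀ t ∈ d.support, t ≤ b) → MvPowerSeries.coeff d f = 0) :
    f = ∑ t ∈ Finset.Ioc b N, X t * lastVarPart t f := by
  classical
  ext d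
  rw [map_sum]
  simp only [coeff_X_mul_lastVarPart]
  by_cases hd : MvPowerSeries.coeff d f = 0
  · simp [hd]
  have hex : ∃ t ∈ d.support, b < t := by
    by_contra! h
    exact hd (h0 d h)
  obtain ⟨u, hu, hbu⟩ := hex
  have hne : d.support.Nonempty := ⟨u, hu⟩
  have hmax := d.support.max'_mem hne
  -- Only the index of the last variable of `d` contributes.
  rw [Finset.sum_eq_single (d.support.max' hne), if_pos ⟨hmax, fun s hs => d.support.le_max' s hs⟩]
  · intro t _ ht
    exact if_neg fun h => ht (le_antisymm (d.support.le_max' t h.1) (h.2 _ hmax))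
  · intro h
    exact absurd (Finset.mem_Ioc.2 ⟨hbu.trans_le (d.support.le_max' u hu), hN d hd _ hmax⟩) h

/-- The bounds `b` and `N` stay fixed through the induction; `0 ≤ N` keeps the subtracted element of
`QSym 0` within the variables up to `N`. The strict degree bound makes the base case `f = 0`. -/
theorem mem_range_of_degree_lt {b N : ℤ} (hb : b ≤ 0) (hN0 : 0 ≤ N) (n : ℕ) :
    ∀ f : Series, (∀ d, MvPowerSeries.coeff d f ≠ 0 → d.degree < n) → VarsLE N f →
      IsBackQuasisymmetricAt b f → f ∈ naturalMap.range := by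
  induction n with
  | zero =>
    intro f hn _ _
    have : f = 0 := by
      ext d
      by_contra h
      exact absurd (hn d h) (Nat.not_lt_zero _)
    rw [this]
    exact naturalMap.range.zero_mem
  | succ n ih =>
    intro f hn hN hf
    have hG := translate_mem_QSym hn hf
    have hGb : IsBackQuasisymmetricAt b (translate b f) :=
      (relabelInvariant_iff.1 (relabelInvariant_of_mem_QSym hG)).mono hb
    rw [← sub_add_cancel f (translate b f)]
    refine naturalMap.range.add_mem ?_ (QSym_le_range hG)
    generalize hh : f - translate b f = h
    have hneg : f - translate b f = f + algebraMap ℚ Series (-1) * translate b f := by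
      rw [map_neg, map_one, neg_one_mul, sub_eq_add_neg]
    have hhb : IsBackQuasisymmetricAt b h := by
      rw [← hh, hneg]
      exact hf.add ((isBackQuasisymmetricAt_algebraMap b _).mul hGb)
    have hhN : VarsLE N h := by
      rw [← hh, hneg]
      exact hN.add ((varsLE_algebraMap N _).mul (hG.2.1.mono hN0))
    have hhn : ∀ d, MvPowerSeries.coeff d h ≠ 0 → d.degree < n + 1 := by
      intro d hd
      by_contra hlt
      have h1 : MvPowerSeries.coeff d f = 0 := by
        by_contra h1
        exact hlt (hn d h1)
      have h2 : MvPowerSeries.coeff d (translate b f) = 0 := by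
        by_contra h2
        exact hlt (degree_lt_of_coeff_translate_ne_zero hn h2)
      exact hd (by rw [← hh, map_sub, h1, h2, sub_zero])
    have hh0 : ∀ d : ℤ →₀ ℕ, (∀ t ∈ d.support, t ≤ b) → MvPowerSeries.coeff d h = 0 := by
      intro d hd
      -- On monomials in the variables up to `b`, the shift by `b ≤ 0` does not change the
      -- coefficient of `f`, so the two terms cancel.
      rw [← hh, map_sub, coeff_translate, if_pos fun t ht => (hd t ht).trans hb,
        (relabelInvariant_iff.2 hf).coeff_mapDomain_add hb hd, sub_self]
    rw [eq_sum_X_mul_lastVarPart hhN hh0]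
    refine naturalMap.range.sum_mem fun t ht => naturalMap.range.mul_mem (X_mem_range t) ?_
    have hcoeff : ∀ d, MvPowerSeries.coeff d (lastVarPart t h) ≠ 0 →
        (∀ s ∈ d.support, s ≤ t) ∧ MvPowerSeries.coeff (d + Finsupp.single t 1) h ≠ 0 := by
      intro d hd
      rw [coeff_lastVarPart] at hd
      by_cases hs : ∀ s ∈ d.support, s ≤ t
      · rw [if_pos hs] at hd
        exact ⟨hs, hd⟩
      · exact absurd (if_neg hs) hd
    refine ih _ (fun d hd => ?_) (fun d hd s hs => ?_)
      (isBackQuasisymmetricAt_lastVarPart (Finset.mem_Ioc.1 ht).1 hhb)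
    · have := hhn _ (hcoeff d hd).2
      rw [map_add, Finsupp.degree_single] at this
      omega
    · exact ((hcoeff d hd).1 s hs).trans (Finset.mem_Ioc.1 ht).2

theorem BackQSym_le_range : BackQSym ≤ naturalMap.range := by
  rintro f ⟨⟨⟨n, hn⟩, N, hN⟩, b, hb⟩
  exact mem_range_of_degree_lt (min_le_right b 0) (le_max_right N 0) (n + 1) f
    (fun d hd => Nat.lt_succ_of_le (hn d hd)) (hN.mono (le_max_left _ _))
    (hb.mono (min_le_left _ _))

/-! ### Injectivity -/

theorem coeff_sum_mul_monomial_of_maximal {b : ℤ} {c : (ℤ →₀ ℕ) →₀ QSym 0} {D : ℕ}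
    (hD : ∀ m ∈ c.support, ∀ d, MvPowerSeries.coeff d (c m : Series) ≠ 0 → d.degree ≤ D)
    (hb : ∀ m ∈ c.support, ∀ t ∈ m.support, b < t) {m d : ℤ →₀ ℕ} (hm : m ∈ c.support)
    (hd : ∀ t ∈ d.support, t ≤ b) (hdeg : d.degree = D) :
    MvPowerSeries.coeff (d + m) (∑ m ∈ c.support, (c m : Series) * monomial m 1) =
      MvPowerSeries.coeff d (c m : Series) := by
  classical
  rw [map_sum, Finset.sum_eq_single_of_mem m hm]
  · rw [coeff_mul_monomial, if_pos le_add_self, add_tsub_cancel_right, mul_one]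
  · intro m' hm' hne
    rw [coeff_mul_monomial]
    split_ifs with hle
    swap
    · rfl
    -- All variables of `m'` lie beyond `b`, where `d` has exponent zero.
    have hle' : m' ≤ m := by
      intro t
      by_cases ht : t ∈ m'.support
      · have h0 : d t = 0 := by
          by_contra h0
          exact absurd (hd t (Finsupp.mem_support_iff.2 h0)) (not_le.2 (hb m' hm' t ht))
        have := hle t
        rwa [Finsupp.add_apply, h0, zero_add] at this
      · rw [Finsupp.notMem_support_iff.1 ht]
        exact Nat.zero_le _
    rw [mul_one]
    by_contra h
    -- The cofactor has degree `D + deg (m - m')`, so the bound `D` forces `m = m'`.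
    have hle2 := hD m' hm' _ h
    rw [add_tsub_assoc_of_le hle', map_add, hdeg] at hle2
    have hz : (m - m').degree = 0 := by omega
    rw [Finsupp.degree_eq_zero_iff] at hz
    exact hne (le_antisymm hle' (tsub_eq_zero_iff_le.1 hz))

theorem eq_zero_of_sum_mul_monomial_eq_zero {c : (ℤ →₀ ℕ) →₀ QSym 0}
    (h : ∑ m ∈ c.support, (c m : Series) * monomial m 1 = 0) : c = 0 := by
  classical
  by_contra hc
  set S : Set ℕ := {D | ∃ m ∈ c.support, ∃ d : ℤ →₀ ℕ,
    MvPowerSeries.coeff d (c m : Series) ≠ 0 ∧ d.degree = D}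
  have hne : S.Nonempty := by
    obtain ⟨m, hm⟩ := Finsupp.support_nonempty_iff.2 hc
    have hcm : (c m : Series) ≠ 0 := fun h0 => Finsupp.mem_support_iff.1 hm (Subtype.ext h0)
    obtain ⟨d, hd⟩ := (MvPowerSeries.ne_zero_iff_exists_coeff_ne_zero _).1 hcm
    exact ⟨_, m, hm, d, hd, rfl⟩
  have hbdd : BddAbove S := by
    choose n hn using fun m => (c m).2.1
    refine ⟨c.support.sup n, ?_⟩
    rintro _ ⟨m, hm, d, hd, rfl⟩
    exact (hn m d hd).trans (Finset.le_sup hm)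
  obtain ⟨m, hm, d, hd, hdeg⟩ := Nat.sSup_mem hne hbdd
  obtain ⟨b, hb0, hb⟩ : ∃ b : ℤ, b ≤ 0 ∧ ∀ m ∈ c.support, ∀ t ∈ m.support, b < t := by
    obtain ⟨b, hb⟩ := (c.support.biUnion Finsupp.support).bddBelow
    refine ⟨min (b - 1) 0, min_le_right _ _, fun m hm t ht => ?_⟩
    have : b ≤ t := hb (Finset.mem_biUnion.2 ⟨m, hm, ht⟩)
    omega
  have hd0 := (c m).2.2.1 d hd
  have hcoeff := coeff_sum_mul_monomial_of_maximal (d := d.mapDomain (· + b))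
    (fun m hm d hd => le_csSup hbdd ⟨m, hm, d, hd, rfl⟩) hb hm (fun t ht => by
      obtain ⟨s, hs, rfl⟩ := mem_support_mapDomain_add ht
      have := hd0 s hs
      omega) ((degree_mapDomain _ d).trans hdeg)
  rw [h, map_zero, (relabelInvariant_of_mem_QSym (c m).2).coeff_mapDomain_add hb0 hd0] at hcoeff
  exact hd hcoeff.symm

theorem naturalMap_injective : Function.Injective naturalMap := by
  rw [injective_iff_map_eq_zero]
  intro z hz
  -- Monomials form a `ℚ`-basis of the polynomial ring, so it suffices that the coefficients in
  -- `QSym 0` vanish.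
  obtain ⟨c, rfl⟩ := TensorProduct.eq_repr_basis_right (MvPolynomial.basisMonomials ℤ ℚ) z
  have hc : c = 0 := by
    apply eq_zero_of_sum_mul_monomial_eq_zero
    rw [← hz, Finsupp.sum, map_sum]
    refine Finset.sum_congr rfl fun m _ => ?_
    rw [naturalMap_tmul, MvPolynomial.coe_basisMonomials, MvPolynomial.coe_monomial]
  rw [hc, Finsupp.sum_zero_index]

end BackQuasi

/-- The natural map from the abstract tensor product `QSym(x_-) ⊗ ℚ[x]` to formal power series is
injective, and its image is exactly the space of back quasisymmetric functions. -/
theorem mainTheorem4 :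
    Function.Injective BackQuasi.naturalMap ∧
      BackQuasi.naturalMap.range = BackQuasi.BackQSym :=
  ⟨BackQuasi.naturalMap_injective,
    le_antisymm BackQuasi.range_naturalMap_le BackQuasi.BackQSym_le_range⟩
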